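/- Let $\mathbf F$ be the category of finite ordinals $n=\{0,\dots,n-1\}$ and all functions, with the chosen coproducts $\iota_{\vec m,i}\colon m_i\to\sum_{k\in n} m_k$, $\iota_{\vec m,i}(j)=\sum_{k<i}m_k+j$. For $\beta\colon n'\to n$ and $\alpha_i\colon m'_i\to m_i$ $(i\in n)$ let $\beta\star\vec\alpha\colon\sum_{i'\in n'}m'_{\beta(i')}\to\sum_{i\in n}m_i$ be the function that sends the $j$-th element of the $i'$-th summand to the $\alpha_{\beta(i')}(j)$-th element of the $\beta(i')$-th summand. A *verbal category* is a wide subcategory $\mathbf W$ of $\mathbf F$ closed under $\star$. Examples are $\mathbf F$ and its wide subcategories $\mathbf F_{\mathrm{id}}$, $\mathbf F_{\mathrm{m,inj}}$, $\mathbf F_{\mathrm{bij}}$, $\mathbf F_{\mathrm{inj}}$, $\mathbf F_{\mathrm{surj}}$, whose morphisms are the identities, monotone injections, bijections, injections and surjections, respectively. A *$\mathbf W$-operad* consists of a functor $O\colon\mathbf W\to\mathbf{Set}$ (write $O_n$ for $O(n)$ and $\alpha p$ for $(O\alpha)(p)$), an element $\mathsf{id}\in O_1$, and functions $\mathsf{subst}_{n,\vec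 m}\colon O_n\times\prod_{i\in n}O_{m_i}\to O_{\sum_i m_i}$ such that $\mathsf{subst}(\beta q,(\alpha_ip_i)_{i\in n})=(\beta\star\vec\alpha)\,\mathsf{subst}(q,(p_{\beta(i')})_{i'\in n'})$ for all $\beta\colon n'\to n$ and $\alpha_i\colon m'_i\to m_i$ in $\mathbf W$, $q\in O_{n'}$, $p_i\in O_{m'_i}$, and such that the usual unit and associativity laws of operads hold. A morphism of $\mathbf W$-operads is a natural transformation preserving $\mathsf{id}$ and $\mathsf{subst}$. A $\mathbf W$-operad $O$ induces a monad on $\mathbf{Set}$. Its functor part is the left Kan extension of $O$ along the inclusion $\mathbf W\to\mathbf{Set}$, which sends $X$ to the quotient of $\sum_{n\in\mathbb N}O_n\times X^n$ by the equivalence relation generated by $(p,\vec x\circ\alpha)\sim(\alpha p,\vec x)$ for $\alpha$ in $\mathbf W$. Its unit is $x\mapsto[\mathsf{id},(x)]$ and its multiplication is $[q,([p_j,\vec x^{(j)}])_{j\in n}]\mapsto[\mathsf{subst}(q,\vec p),(\vec x^{(j)})_{j\in n}]$, where the tuples $\vec x^{(j)}$ are concatenated. A monad $S$ on $\mathbf{Set}$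 is *$\mathbf W$-operadic* if it is isomorphic, as a monad, to the monad induced by some $\mathbf W$-operad; it is *uniquely $\mathbf W$-operadic* if moreover any two $\mathbf W$-operads whose induced monads are isomorphic to $S$ are isomorphic as $\mathbf W$-operads. **Proposition.** If $\mathbf W$ is $\mathbf F_{\mathrm{bij}}$, $\mathbf F_{\mathrm{surj}}$ or $\mathbf F$, then every $\mathbf W$-operadic monad on $\mathbf{Set}$ is uniquely $\mathbf W$-operadic. If $\mathbf W$ is $\mathbf F_{\mathrm{id}}$, $\mathbf F_{\mathrm{m,inj}}$ or $\mathbf F_{\mathrm{inj}}$, then there exists a $\mathbf W$-operadic monad on $\mathbf{Set}$ that is not uniquely $\mathbf W$-operadic. -/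

import Mathlib

open CategoryTheory

universe u

/-! ## Verbal categories

The category `F` has as objects the finite ordinals `n` (realized as `Fin n`) and as morphisms all
functions.  Chosen coproducts in `F`: `∑ i, m i` is the coproduct of the `m i`, with injections
`j ↦ finSigmaFinEquiv ⟨i, j⟩`, whose value is `(∑ k < i, m k) + j`
(see `finSigmaFinEquiv_apply`). -/

/-- The verbal substitution `β ⋆ α`: it sends the `j`-th element of the `i'`-th summand to the
`α (β i') j`-th element of the `β i'`-th summand. -/
def verbalSubst {n' n : ℕ} (β : Fin n' → Fin n) {m' m : Fin n → ℕ}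
    (α : ∀ i, Fin (m' i) → Fin (m i)) :
    Fin (∑ i', m' (β i')) → Fin (∑ i, m i) :=
  fun k => finSigmaFinEquiv
    ⟨β (finSigmaFinEquiv.symm k).1,
      α (β (finSigmaFinEquiv.symm k).1) (finSigmaFinEquiv.symm k).2⟩

/-- A verbal category: a wide subcategory of `F` closed under verbal substitution.
`Mem α` says that the function `α` is a morphism of the subcategory. -/
structure VerbalCategory where
  Mem : ∀ {m n : ℕ}, (Fin m → Fin n) → Prop
  id_mem : ∀ n : ℕ, Mem (id : Fin n → Fin n)
  comp_mem : ∀ {l m n : ℕ} {β : Fin m → Fin n} {α : Fin l → Fin m},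
    Mem β → Mem α → Mem (β ∘ α)
  star_mem : ∀ {n' n : ℕ} {β : Fin n' → Fin n} {m' m : Fin n → ℕ}
    {α : ∀ i, Fin (m' i) → Fin (m i)},
    Mem β → (∀ i, Mem (α i)) → Mem (verbalSubst β α)

/-- If `m = n`, then `Fin.cast` is the identity morphism `m → n` of `F`. -/
theorem VerbalCategory.cast_mem (W : VerbalCategory) {m n : ℕ} (h : m = n) :
    W.Mem (Fin.cast h) := by
  subst h
  exact W.id_mem m

/-! ### Auxiliary facts on the chosen coproducts -/

theorem finSigma_lt_of_fst_lt {n : ℕ} {m : Fin n → ℕ} (a b : (i : Fin n) × Fin (m i))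
    (h : a.1 < b.1) : finSigmaFinEquiv a < finSigmaFinEquiv b := by
  rw [Fin.lt_def, finSigmaFinEquiv_apply, finSigmaFinEquiv_apply]
  have key : ∀ c : Fin n, ∑ i : Fin c, m (Fin.castLE c.2.le i)
      = ∑ i ∈ Finset.range c, (if h : i < n then m ⟨i, h⟩ else 0) := by
    intro c
    rw [Finset.sum_range]
    refine Finset.sum_congr rfl fun i _ => ?_
    rw [dif_pos (i.2.trans c.2)]
    rfl
  rw [key, key]
  have h1 : ∑ i ∈ Finset.range (a.1 + 1), (if h : i < n then m ⟨i, h⟩ else 0)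
      ≤ ∑ i ∈ Finset.range b.1, (if h : i < n then m ⟨i, h⟩ else 0) := by
    apply Finset.sum_le_sum_of_subset
    intro x hx
    simp only [Finset.mem_range] at hx ⊢
    have : (a.1 : ℕ) < b.1 := h
    omega
  rw [Finset.sum_range_succ, dif_pos a.1.2] at h1
  have h2 : (a.2 : ℕ) < m ⟨a.1, a.1.2⟩ := a.2.2
  omega

theorem finSigma_lt_of_snd_lt {n : ℕ} {m : Fin n → ℕ} (i : Fin n) (a b : Fin (m i))
    (h : a < b) : finSigmaFinEquiv ⟨i, a⟩ < finSigmaFinEquiv (n := m) ⟨i, b⟩ := by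
  rw [Fin.lt_def, finSigmaFinEquiv_apply, finSigmaFinEquiv_apply]
  have : (a : ℕ) < b := h
  simp only
  omega

theorem finSigma_lt_cases {n : ℕ} {m : Fin n → ℕ} {a b : (i : Fin n) × Fin (m i)}
    (h : finSigmaFinEquiv a < finSigmaFinEquiv b) :
    a.1 < b.1 ∨ ∃ h : a.1 = b.1, Fin.cast (congrArg m h) a.2 < b.2 := by
  rcases lt_trichotomy a.1 b.1 with h1 | h1 | h1
  · exact Or.inl h1
  · obtain ⟨i, a⟩ := a
    obtain ⟨j, b⟩ := b
    dsimp only at h1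
    subst h1
    refine Or.inr ⟨rfl, ?_⟩
    rcases lt_trichotomy a b with h2 | h2 | h2
    · exact h2
    · subst h2
      exact absurd h (lt_irrefl _)
    · exact absurd h (lt_asymm (finSigma_lt_of_snd_lt _ _ _ h2))
  · exact absurd h (lt_asymm (finSigma_lt_of_fst_lt _ _ h1))

/-- A strictly monotone map between equal finite ordinals is the identity. -/
theorem Fin.strictMono_eq_cast {m n : ℕ} (h : m = n) {f : Fin m → Fin n} (hf : StrictMono f) :
    f = Fin.cast h := by
  subst h
  have h1 := Subsingleton.elim
    (hf.orderIsoOfSurjective f (Finite.injective_iff_surjective.1 hf.injective)) (OrderIso.refl _)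
  funext i
  exact congrArg (fun e : Fin m ≃o Fin m => e i) h1

theorem verbalSubst_apply {n' n : ℕ} (β : Fin n' → Fin n) {m' m : Fin n → ℕ}
    (α : ∀ i, Fin (m' i) → Fin (m i)) (i : Fin n') (a : Fin (m' (β i))) :
    verbalSubst β α (finSigmaFinEquiv ⟨i, a⟩) = finSigmaFinEquiv ⟨β i, α (β i) a⟩ :=
  congrArg (fun y : (i : Fin n') × Fin (m' (β i)) =>
    finSigmaFinEquiv (n := m) ⟨β y.1, α (β y.1) y.2⟩) (Equiv.symm_apply_apply _ _)

theorem verbalSubst_injective {n' n : ℕ} {β : Fin n' → Fin n} {m' m : Fin n → ℕ}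
    {α : ∀ i, Fin (m' i) → Fin (m i)} (hβ : Function.Injective β)
    (hα : ∀ i, Function.Injective (α i)) : Function.Injective (verbalSubst β α) := by
  intro k l h
  obtain ⟨⟨i, a⟩, rfl⟩ := finSigmaFinEquiv.surjective k
  obtain ⟨⟨j, b⟩, rfl⟩ := finSigmaFinEquiv.surjective l
  rw [verbalSubst_apply, verbalSubst_apply] at h
  have h' := finSigmaFinEquiv.injective h
  have hij : i = j := hβ (congrArg Sigma.fst h')
  subst hij
  rw [hα _ (eq_of_heq (Sigma.mk.inj h').2)]

theorem verbalSubst_surjective {n' n : ℕ} {β : Fin n' → Fin n} {m' m : Fin n → ℕ}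
    {α : ∀ i, Fin (m' i) → Fin (m i)} (hβ : Function.Surjective β)
    (hα : ∀ i, Function.Surjective (α i)) : Function.Surjective (verbalSubst β α) := by
  intro l
  obtain ⟨⟨i, b⟩, rfl⟩ := finSigmaFinEquiv.surjective l
  obtain ⟨i', rfl⟩ := hβ i
  obtain ⟨a, rfl⟩ := hα _ b
  exact ⟨finSigmaFinEquiv ⟨i', a⟩, verbalSubst_apply _ _ _ _⟩

theorem verbalSubst_strictMono {n' n : ℕ} {β : Fin n' → Fin n} {m' m : Fin n → ℕ}
    {α : ∀ i, Fin (m' i) → Fin (m i)} (hβ : StrictMono β)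
    (hα : ∀ i, StrictMono (α i)) : StrictMono (verbalSubst β α) := by
  intro k l h
  obtain ⟨⟨i, a⟩, rfl⟩ := finSigmaFinEquiv.surjective k
  obtain ⟨⟨j, b⟩, rfl⟩ := finSigmaFinEquiv.surjective l
  rw [verbalSubst_apply, verbalSubst_apply]
  rcases finSigma_lt_cases h with h1 | ⟨h1, h2⟩
  · exact finSigma_lt_of_fst_lt _ _ (hβ h1)
  · dsimp only at h1
    subst h1
    exact finSigma_lt_of_snd_lt _ _ _ (hα _ h2)

/-! ### The six basic verbal categories -/

/-- `F_id`: only identity functions. -/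
def Fid : VerbalCategory where
  Mem {m n} α := m = n ∧ ∀ i, (α i : ℕ) = i
  id_mem _ := ⟨rfl, fun _ => rfl⟩
  comp_mem hβ hα := ⟨hα.1.trans hβ.1, fun i => (hβ.2 _).trans (hα.2 i)⟩
  star_mem {n' n β m' m α} hβ hα := by
    have hm : m' = m := funext fun i => (hα i).1
    obtain ⟨h, hβ⟩ := hβ
    subst h
    have hb : β = id := funext fun i => Fin.ext (hβ i)
    subst hb
    refine ⟨by simp [hm], fun k => ?_⟩
    have hs : StrictMono (verbalSubst id α) := by
      refine verbalSubst_strictMono strictMono_id fun i a b h => ?_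
      have h1 := (hα i).2 a
      have h2 := (hα i).2 b
      rw [Fin.lt_def] at h ⊢
      omega
    rw [Fin.strictMono_eq_cast (by simp [hm]) hs]
    rfl

/-- `F_m,inj`: monotone injections. -/
def Fminj : VerbalCategory where
  Mem α := Monotone α ∧ Function.Injective α
  id_mem _ := ⟨monotone_id, Function.injective_id⟩
  comp_mem hβ hα := ⟨hβ.1.comp hα.1, hβ.2.comp hα.2⟩
  star_mem hβ hα :=
    have hs := verbalSubst_strictMono (hβ.1.strictMono_of_injective hβ.2)
      fun i => (hα i).1.strictMono_of_injective (hα i).2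
    ⟨hs.monotone, hs.injective⟩

/-- `F_bij`: bijections. -/
def Fbij : VerbalCategory where
  Mem α := Function.Bijective α
  id_mem _ := Function.bijective_id
  comp_mem hβ hα := hβ.comp hα
  star_mem hβ hα := ⟨verbalSubst_injective hβ.1 fun i => (hα i).1,
    verbalSubst_surjective hβ.2 fun i => (hα i).2⟩

/-- `F_inj`: injections. -/
def Finj : VerbalCategory where
  Mem α := Function.Injective α
  id_mem _ := Function.injective_id
  comp_mem hβ hα := hβ.comp hα
  star_mem hβ hα := verbalSubst_injective hβ hα

/-- `F_surj`: surjections. -/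
def Fsurj : VerbalCategory where
  Mem α := Function.Surjective α
  id_mem _ := Function.surjective_id
  comp_mem hβ hα := hβ.comp hα
  star_mem hβ hα := verbalSubst_surjective hβ hα

/-- `F`: all functions. -/
def Fall : VerbalCategory where
  Mem _ := True
  id_mem _ := trivial
  comp_mem _ _ := trivial
  star_mem _ _ := trivial

/-! ## `W`-operads -/

/-- The concatenation of a family of finite tuples. -/
def flattenTuple {X : Type*} {n : ℕ} {m : Fin n → ℕ} (x : ∀ j, Fin (m j) → X) :
    Fin (∑ j, m j) → X :=
  fun k => x (finSigmaFinEquiv.symm k).1 (finSigmaFinEquiv.symm k).2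

theorem flattenTuple_apply {X : Type*} {n : ℕ} {m : Fin n → ℕ} (x : ∀ j, Fin (m j) → X)
    (j : Fin n) (i : Fin (m j)) : flattenTuple x (finSigmaFinEquiv ⟨j, i⟩) = x j i :=
  congrArg (fun y : (j : Fin n) × Fin (m j) => x y.1 y.2) (Equiv.symm_apply_apply _ _)

theorem sum_sum_eq_sum_finSigma {n : ℕ} (m : Fin n → ℕ) (l : ∀ j, Fin (m j) → ℕ) :
    ∑ j, ∑ i, l j i = ∑ k, flattenTuple l k := by
  rw [← Fintype.sum_sigma' (fun j i => l j i)]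
  exact (Equiv.sum_comp finSigmaFinEquiv.symm
    (fun y : (j : Fin n) × Fin (m j) => l y.1 y.2)).symm

/-- A `W`-operad.  The fields `obj, act, act_id, act_comp` are a functor `W ⥤ Type u`.
In the unit and associativity laws, whose two sides live in `obj` of two numbers that are equal but
not syntactically so, the action of the identity `Fin.cast` makes them comparable. -/
structure WOperad (W : VerbalCategory) where
  obj : ℕ → Type u
  act : ∀ {m n : ℕ} (α : Fin m → Fin n), W.Mem α → obj m → obj n
  act_id : ∀ {n : ℕ} (p : obj n), act id (W.id_mem n) p = p
  act_comp : ∀ {l m n : ℕ} (β : Fin m → Fin n) (α : Fin l → Fin m) (hβ : W.Mem β) (hα : W.Mem α)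
    (p : obj l), act (β ∘ α) (W.comp_mem hβ hα) p = act β hβ (act α hα p)
  ido : obj 1
  subst : ∀ {n : ℕ} {m : Fin n → ℕ}, obj n → (∀ i, obj (m i)) → obj (∑ i, m i)
  subst_act : ∀ {n' n : ℕ} (β : Fin n' → Fin n) (hβ : W.Mem β) {m' m : Fin n → ℕ}
    (α : ∀ i, Fin (m' i) → Fin (m i)) (hα : ∀ i, W.Mem (α i))
    (q : obj n') (p : ∀ i, obj (m' i)),
    subst (act β hβ q) (fun i => act (α i) (hα i) (p i)) =
      act (verbalSubst β α) (W.star_mem hβ hα) (subst q (fun i' => p (β i')))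
  subst_ido : ∀ {m : ℕ} (p : obj m),
    act (Fin.cast (by simp)) (W.cast_mem _) (subst ido (fun _ => p)) = p
  subst_idos : ∀ {m : ℕ} (p : obj m),
    act (Fin.cast (by simp)) (W.cast_mem _) (subst p (fun _ => ido)) = p
  subst_assoc : ∀ {n : ℕ} {m : Fin n → ℕ} {l : ∀ j, Fin (m j) → ℕ} (r : obj n)
    (q : ∀ j, obj (m j)) (p : ∀ j i, obj (l j i)),
    act (Fin.cast (sum_sum_eq_sum_finSigma m l)) (W.cast_mem _)
        (subst r (fun j => subst (q j) (p j))) =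
      subst (m := flattenTuple l) (subst r q)
        (fun k => p (finSigmaFinEquiv.symm k).1 (finSigmaFinEquiv.symm k).2)

namespace WOperad

variable {W : VerbalCategory}

/-- A morphism of `W`-operads: a natural transformation compatible with `ido` and `subst`. -/
@[ext]
structure Hom (O P : WOperad.{u} W) where
  app : ∀ n, O.obj n → P.obj n
  naturality : ∀ {m n : ℕ} (α : Fin m → Fin n) (hα : W.Mem α) (p : O.obj m),
    app n (O.act α hα p) = P.act α hα (app m p)
  app_ido : app 1 O.ido = P.ido
  app_subst : ∀ {n : ℕ} {m : Fin n → ℕ} (q : O.obj n) (p : ∀ i, O.obj (m i)),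
    app (∑ i, m i) (O.subst q p) = P.subst (app n q) (fun i => app (m i) (p i))

/-- The category of `W`-operads; `O ≅ P` below is isomorphism in this category. -/
instance : Category (WOperad.{u} W) where
  Hom := Hom
  id O := ⟨fun _ p => p, fun _ _ _ => rfl, rfl, fun _ _ => rfl⟩
  comp f g := ⟨fun n p => g.app n (f.app n p),
    fun α hα p => by rw [f.naturality, g.naturality],
    by rw [f.app_ido, g.app_ido],
    fun q p => by rw [f.app_subst, g.app_subst]⟩
  id_comp _ := rfl
  comp_id _ := rfl
  assoc _ _ _ := rfl

/-! ## The monad induced by a `W`-operad -/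

variable (O : WOperad.{u} W)

/-- The set `∑ n, O_n × X ^ n`. -/
abbrev Pre (X : Type u) : Type u := Σ n : ℕ, O.obj n × (Fin n → X)

/-- The generating relation `(p, x ∘ α) ∼ (α p, x)`, for `α` in `W`. -/
def Rel (X : Type u) (a b : O.Pre X) : Prop :=
  ∃ (α : Fin a.1 → Fin b.1) (hα : W.Mem α), a.2.2 = b.2.2 ∘ α ∧ b.2.1 = O.act α hα a.2.1

/-- The value at `X` of the left Kan extension of `O` along the inclusion `W ⥤ Set`: the
coend `∫ n ∈ W, O_n × X ^ n`, i.e. the quotient of `∑ n, O_n × X ^ n` by the equivalence relation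
generated by `Rel`. -/
def Lan (X : Type u) : Type u := Quot (O.Rel X)

variable {O}

/-- The class `[p, x]`. -/
def Lan.mk {X : Type u} {n : ℕ} (p : O.obj n) (x : Fin n → X) : O.Lan X :=
  Quot.mk _ ⟨n, p, x⟩

theorem Lan.ind {X : Type u} {motive : O.Lan X → Prop}
    (h : ∀ {n : ℕ} (p : O.obj n) (x : Fin n → X), motive (Lan.mk p x)) (t : O.Lan X) :
    motive t :=
  Quot.ind (fun a => h a.2.1 a.2.2) t

theorem Lan.mk_act {X : Type u} {m n : ℕ} (α : Fin m → Fin n) (hα : W.Mem α) (p : O.obj m)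
    (x : Fin n → X) : Lan.mk (O.act α hα p) x = Lan.mk p (x ∘ α) :=
  (Quot.sound ⟨α, hα, rfl, rfl⟩).symm

/-- The functorial action `[p, x] ↦ [p, f ∘ x]`. -/
def Lan.map {X Y : Type u} (f : X → Y) : O.Lan X → O.Lan Y :=
  Quot.lift (fun a => Lan.mk a.2.1 (f ∘ a.2.2)) (by
    rintro ⟨m, p, x⟩ ⟨n, q, y⟩ ⟨α, hα, h1, h2⟩
    dsimp only at α hα h1 h2 ⊢
    subst h1 h2
    exact (Lan.mk_act α hα p (f ∘ y)).symm)

theorem Lan.map_mk {X Y : Type u} (f : X → Y) {n : ℕ} (p : O.obj n) (x : Fin n → X) :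
    Lan.map f (Lan.mk p x) = Lan.mk p (f ∘ x) := rfl

/-- `[subst(q, p), (x_j)_j]` for `q ∈ O_n` and a family `(p_j, x_j)` of representatives. -/
def Lan.bindPre {X : Type u} {n : ℕ} (q : O.obj n) (a : Fin n → O.Pre X) : O.Lan X :=
  Lan.mk (O.subst q (fun j => (a j).2.1)) (flattenTuple (fun j => (a j).2.2))

theorem Lan.bindPre_act {X : Type u} {n' n : ℕ} (β : Fin n' → Fin n) (hβ : W.Mem β)
    (q : O.obj n') (a b : Fin n → O.Pre X) (h : ∀ j, O.Rel X (a j) (b j)) :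
    Lan.bindPre (O.act β hβ q) b = Lan.bindPre q (a ∘ β) := by
  choose α hα h1 h2 using h
  unfold Lan.bindPre
  simp only [h2]
  rw [O.subst_act β hβ α hα q, Lan.mk_act]
  congr 1
  funext k
  obtain ⟨⟨i, c⟩, rfl⟩ := finSigmaFinEquiv.surjective k
  rw [Function.comp_apply, verbalSubst_apply, flattenTuple_apply, flattenTuple_apply]
  exact (congrFun (h1 (β i)) c).symm

theorem Rel.refl {X : Type u} (a : O.Pre X) : O.Rel X a a :=
  ⟨id, W.id_mem _, rfl, (O.act_id _).symm⟩

theorem Lan.bindPre_congr {X : Type u} {n : ℕ} (q : O.obj n) (a b : Fin n → O.Pre X)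
    (h : ∀ j, Quot.mk (O.Rel X) (a j) = Quot.mk (O.Rel X) (b j)) :
    Lan.bindPre q a = Lan.bindPre q b := by
  classical
  have step : ∀ (c : Fin n → O.Pre X) (j : Fin n) (x y : O.Pre X),
      Relation.EqvGen (O.Rel X) x y →
      Lan.bindPre q (Function.update c j x) = Lan.bindPre q (Function.update c j y) := by
    intro c j x y hxy
    induction hxy with
    | rel x y hr =>
      have := Lan.bindPre_act id (W.id_mem n) q (Function.update c j x) (Function.update c j y)
        (fun i => by
          by_cases hi : i = j
          · subst hi
            simpa using hr
          · simpa [hi] using Rel.refl _)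
      rw [O.act_id] at this
      exact this.symm
    | refl => rfl
    | symm _ _ _ ih => exact ih.symm
    | trans _ _ _ _ _ ih1 ih2 => exact ih1.trans ih2
  have main : ∀ s : Finset (Fin n), Lan.bindPre q (s.piecewise b a) = Lan.bindPre q a := by
    intro s
    induction s using Finset.induction_on with
    | empty => simp
    | insert j s hj ih =>
      rw [Finset.piecewise_insert, ← ih]
      have := step (s.piecewise b a) j (b j) (a j) (Quot.eqvGen_exact (h j).symm)
      rw [this]
      congr 1
      refine Function.update_eq_self_iff.2 ?_
      rw [Finset.piecewise_eq_of_notMem _ _ _ hj]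
  have := main Finset.univ
  rw [Finset.piecewise_univ] at this
  exact this.symm

/-- The multiplication `[q, ([p_j, x_j])_j] ↦ [subst(q, p), (x_j)_j]`; see `Lan.join_mk`. -/
noncomputable def Lan.join {X : Type u} : O.Lan (O.Lan X) → O.Lan X :=
  Quot.lift (fun a => Lan.bindPre a.2.1 (fun j => Quot.out (a.2.2 j))) (by
    rintro ⟨m, p, x⟩ ⟨n, q, y⟩ ⟨α, hα, h1, h2⟩
    dsimp only at α hα h1 h2 ⊢
    subst h1 h2
    exact (Lan.bindPre_act α hα p (fun j => Quot.out (y j)) _ (fun _ => Rel.refl _)).symm)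

theorem Lan.join_mk {X : Type u} {n : ℕ} {m : Fin n → ℕ} (q : O.obj n) (p : ∀ j, O.obj (m j))
    (x : ∀ j, Fin (m j) → X) :
    Lan.join (Lan.mk q (fun j => Lan.mk (p j) (x j))) =
      Lan.mk (O.subst q p) (flattenTuple x) :=
  Lan.bindPre_congr q _ (fun j => ⟨m j, p j, x j⟩) (fun _ => Quot.out_eq _)

/-- The unit `x ↦ [ido, (x)]`. -/
def Lan.pure {X : Type u} (x : X) : O.Lan X := Lan.mk O.ido (fun _ => x)

theorem Lan.exists_rep {X : Type u} {n : ℕ} (y : Fin n → O.Lan X) :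
    ∃ (m : Fin n → ℕ) (p : ∀ j, O.obj (m j)) (x : ∀ j, Fin (m j) → X),
      y = fun j => Lan.mk (p j) (x j) :=
  ⟨fun j => (Quot.out (y j)).1, fun j => (Quot.out (y j)).2.1, fun j => (Quot.out (y j)).2.2,
    funext fun j => (Quot.out_eq (y j)).symm⟩

theorem Lan.join_map {X Y : Type u} (f : X → Y) (t : O.Lan (O.Lan X)) :
    Lan.join (Lan.map (Lan.map f) t) = Lan.map f (Lan.join t) := by
  induction t using Lan.ind with
  | h q y =>
    obtain ⟨m, p, x, rfl⟩ := Lan.exists_rep y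
    rw [Lan.map_mk, Lan.join_mk, Lan.map_mk]
    exact Lan.join_mk q p fun j => f ∘ x j

theorem Lan.join_pure {X : Type u} (t : O.Lan X) : Lan.join (Lan.pure t) = t := by
  induction t using Lan.ind with
  | @h n p x =>
    unfold Lan.pure
    rw [Lan.join_mk]
    conv_rhs => rw [← O.subst_ido p, Lan.mk_act]
    congr 1
    funext k
    obtain ⟨⟨i, a⟩, rfl⟩ := finSigmaFinEquiv.surjective k
    rw [flattenTuple_apply, Function.comp_apply]
    congr 1
    exact Fin.ext (finSigmaFinEquiv_one (n := fun _ => n) ⟨i, a⟩).symm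

theorem Lan.join_map_pure {X : Type u} (t : O.Lan X) : Lan.join (Lan.map Lan.pure t) = t := by
  induction t using Lan.ind with
  | @h n p x =>
    rw [Lan.map_mk]
    refine (Lan.join_mk p (fun _ => O.ido) (fun j _ => x j)).trans ?_
    conv_rhs => rw [← O.subst_idos p, Lan.mk_act]
    congr 1
    have hs : StrictMono (fun i : Fin n =>
        finSigmaFinEquiv (n := fun _ : Fin n => 1) ⟨i, 0⟩) :=
      fun i j h => finSigma_lt_of_fst_lt _ _ h
    have hs' := Fin.strictMono_eq_cast (by simp) hs
    funext k
    obtain ⟨⟨i, a⟩, rfl⟩ := finSigmaFinEquiv.surjective k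
    obtain rfl : a = 0 := Subsingleton.elim _ _
    rw [flattenTuple_apply, Function.comp_apply]
    congr 1
    have := congrFun hs' i
    exact Fin.ext (congrArg Fin.val this).symm

theorem flattenTuple_flattenTuple {X : Type u} {n : ℕ} {m : Fin n → ℕ}
    {l : ∀ j, Fin (m j) → ℕ} (x : ∀ j i, Fin (l j i) → X) :
    flattenTuple (fun j => flattenTuple (x j)) =
      flattenTuple (m := flattenTuple l)
        (fun k => x (finSigmaFinEquiv.symm k).1 (finSigmaFinEquiv.symm k).2) ∘
      Fin.cast (sum_sum_eq_sum_finSigma m l) := by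
  let f : Fin (∑ k, flattenTuple l k) → Fin (∑ j, ∑ i, l j i) := fun k =>
    finSigmaFinEquiv (n := fun j => ∑ i, l j i)
      ⟨(finSigmaFinEquiv.symm (finSigmaFinEquiv.symm k).1).1,
        finSigmaFinEquiv (n := l _)
          ⟨(finSigmaFinEquiv.symm (finSigmaFinEquiv.symm k).1).2, (finSigmaFinEquiv.symm k).2⟩⟩
  have aux : ∀ (b b' : (j : Fin n) × Fin (m j)) (c : Fin (l b.1 b.2)) (c' : Fin (l b'.1 b'.2)),
      finSigmaFinEquiv b < finSigmaFinEquiv b' →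
      finSigmaFinEquiv (n := fun j => ∑ i, l j i) ⟨b.1, finSigmaFinEquiv (n := l _) ⟨b.2, c⟩⟩ <
      finSigmaFinEquiv (n := fun j => ∑ i, l j i)
        ⟨b'.1, finSigmaFinEquiv (n := l _) ⟨b'.2, c'⟩⟩ := by
    rintro ⟨j, i⟩ ⟨j', i'⟩ c c' h
    rcases finSigma_lt_cases h with h3 | ⟨h3, h4⟩
    · exact finSigma_lt_of_fst_lt _ _ h3
    · dsimp only at h3
      subst h3
      exact finSigma_lt_of_snd_lt _ _ _ (finSigma_lt_of_fst_lt _ _ h4)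
  have aux2 : ∀ y y' : (k : Fin (∑ j, m j)) × Fin (flattenTuple l k),
      finSigmaFinEquiv y < finSigmaFinEquiv y' →
      finSigmaFinEquiv (n := fun j => ∑ i, l j i) ⟨(finSigmaFinEquiv.symm y.1).1,
        finSigmaFinEquiv (n := l _) ⟨(finSigmaFinEquiv.symm y.1).2, y.2⟩⟩ <
      finSigmaFinEquiv (n := fun j => ∑ i, l j i) ⟨(finSigmaFinEquiv.symm y'.1).1,
        finSigmaFinEquiv (n := l _) ⟨(finSigmaFinEquiv.symm y'.1).2, y'.2⟩⟩ := by
    rintro ⟨a, c⟩ ⟨a', c'⟩ h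
    rcases finSigma_lt_cases h with h1 | ⟨h1, h2⟩
    · exact aux _ _ _ _ (by simpa using h1)
    · dsimp only at h1
      subst h1
      exact finSigma_lt_of_snd_lt _ _ _ (finSigma_lt_of_snd_lt _ _ _ h2)
  have hf : StrictMono f := fun k k' h => aux2 _ _ (by simpa using h)
  have hc := Fin.strictMono_eq_cast (sum_sum_eq_sum_finSigma m l).symm hf
  funext k
  obtain ⟨k, rfl⟩ : ∃ k', k = Fin.cast (sum_sum_eq_sum_finSigma m l).symm k' :=
    ⟨Fin.cast (sum_sum_eq_sum_finSigma m l) k, rfl⟩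
  rw [← hc]
  have hcc : Fin.cast (sum_sum_eq_sum_finSigma m l) (f k) = k := by rw [hc]; rfl
  rw [Function.comp_apply, hcc]
  exact (flattenTuple_apply _ _ _).trans (flattenTuple_apply _ _ _)

theorem Lan.join_assoc {X : Type u} (t : O.Lan (O.Lan (O.Lan X))) :
    Lan.join (Lan.map Lan.join t) = Lan.join (Lan.join t) := by
  induction t using Lan.ind with
  | @h n r y =>
    obtain ⟨m, q, z, rfl⟩ := Lan.exists_rep y
    choose l p x hz using fun j => Lan.exists_rep (z j)
    obtain rfl : z = fun j i => Lan.mk (p j i) (x j i) := funext hz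
    rw [Lan.map_mk, Lan.join_mk]
    have h1 : (Lan.join ∘ fun j => Lan.mk (q j) fun i => Lan.mk (p j i) (x j i)) =
        fun j => Lan.mk (O.subst (q j) (p j)) (flattenTuple (x j)) :=
      funext fun j => Lan.join_mk _ _ _
    rw [h1, Lan.join_mk]
    refine Eq.trans ?_ (Lan.join_mk (m := flattenTuple l) (O.subst r q)
      (fun k => p (finSigmaFinEquiv.symm k).1 (finSigmaFinEquiv.symm k).2)
      (fun k => x (finSigmaFinEquiv.symm k).1 (finSigmaFinEquiv.symm k).2)).symm
    rw [← O.subst_assoc, Lan.mk_act, flattenTuple_flattenTuple]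

variable (O)

/-- The monad on `Set` induced by the `W`-operad `O`. -/
noncomputable def toMonad : Monad (Type u) where
  obj X := O.Lan X
  map f := ↾(Lan.map (O := O) (fun x => f x))
  map_id X := by
    ext t
    induction t using Lan.ind with
    | h p x => rfl
  map_comp f g := by
    ext t
    induction t using Lan.ind with
    | h p x => rfl
  η := { app := fun X => ↾(Lan.pure (O := O) (X := X))
         naturality := fun X Y f => by ext x; rfl }
  μ := { app := fun X => ↾(Lan.join (O := O) (X := X))
         naturality := fun X Y f => by ext t; exact Lan.join_map _ t }
  assoc X := by ext t; exact Lan.join_assoc t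
  left_unit X := by ext t; exact Lan.join_pure t
  right_unit X := by ext t; exact Lan.join_map_pure t

end WOperad

/-- A monad on `Set` is `W`-operadic if it is isomorphic to the monad induced by some
`W`-operad. -/
def IsOperadic (W : VerbalCategory) (S : Monad (Type u)) : Prop :=
  ∃ O : WOperad.{u} W, Nonempty (O.toMonad ≅ S)

/-- A monad on `Set` is uniquely `W`-operadic if a `W`-operad inducing it exists and is unique up
to isomorphism of `W`-operads. -/
def IsUniquelyOperadic (W : VerbalCategory) (S : Monad (Type u)) : Prop :=
  ∃ O : WOperad.{u} W, Nonempty (O.toMonad ≅ S) ∧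
    ∀ O' : WOperad.{u} W, Nonempty (O'.toMonad ≅ S) → Nonempty (O' ≅ O)

/-! Uniqueness: an operation `p` of arity `n` is represented in the monad by the class `generic O p`
of `p` with the identity tuple. For bijections, surjections and all functions, whether the tuple of
a class over `n` lies in `W` does not depend on the representative, so acting along such tuples is
well defined on classes (`evalMem`) and recovers `p`. A monad isomorphism preserves generic classes
(`exists_generic_eq`): passing back and forth gives composable tuples `x`, `y`, `z` with `x ∘ y` and
`y ∘ z` in `W`, which forces `x` into `W`. Unit, action and substitution of the operad are monad
operations on generic classes, so the resulting bijections form an operad isomorphism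
(`nonempty_iso_of_toMonad_iso`).

Non-uniqueness: for injections, monotone or not, two operads induce the monad that is empty on the
empty set and a point elsewhere. One has a single operation in each positive arity; the other has,
in addition, an identity distinct from the unary operation. The quotient cannot separate the latter
two, since injections into larger arities merge them. For `Fid`, multiplying in a nontrivial monoid
by the first or by the last argument gives non-isomorphic operads, but reversal of tuples identifies
their monads. -/

/-! ## Recovering an operad from its monad -/

namespace WOperad

variable {W : VerbalCategory}

/-- The monad isomorphism at `X`, as a function between the quotients. -/
def isoApp {O P : WOperad.{u} W} (e : O.toMonad ≅ P.toMonad) (X : Type u) (t : O.Lan X) :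
    P.Lan X :=
  e.hom.app X t

theorem isoApp_map {O P : WOperad.{u} W} (e : O.toMonad ≅ P.toMonad) {X Y : Type u}
    (f : X → Y) (t : O.Lan X) :
    isoApp e Y (Lan.map f t) = Lan.map f (isoApp e X t) :=
  ConcreteCategory.congr_hom (e.hom.naturality (↾f)) t

theorem isoApp_pure {O P : WOperad.{u} W} (e : O.toMonad ≅ P.toMonad) {X : Type u} (x : X) :
    isoApp e X (Lan.pure x) = Lan.pure x :=
  ConcreteCategory.congr_hom (e.hom.app_η X) x

theorem isoApp_join {O P : WOperad.{u} W} (e : O.toMonad ≅ P.toMonad) {X : Type u}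
    (t : O.Lan (O.Lan X)) :
    isoApp e X (Lan.join t) = Lan.join (isoApp e _ (Lan.map (isoApp e X) t)) := by
  rw [isoApp_map]
  have h := ConcreteCategory.congr_hom (e.hom.app_μ X) t
  refine h.trans ?_
  change Lan.join (isoApp e _ (Lan.map (isoApp e X) t)) = _
  rw [isoApp_map]

theorem isoApp_symm_isoApp {O P : WOperad.{u} W} (e : O.toMonad ≅ P.toMonad) {X : Type u}
    (t : O.Lan X) : isoApp e.symm X (isoApp e X t) = t := by
  have h := congrArg (fun f : O.toMonad ⟶ O.toMonad => f.app X) e.hom_inv_id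
  exact ConcreteCategory.congr_hom h t

end WOperad

/-! ### Operad structure expressed through generic classes -/

namespace WOperad

variable {W : VerbalCategory}

/-- The class `[p, id]` in `Lan O n`. -/
def generic (O : WOperad.{u} W) {n : ℕ} (p : O.obj n) : O.Lan (ULift.{u} (Fin n)) :=
  Lan.mk p ULift.up

theorem mk_eq_map_generic {O : WOperad.{u} W} {X : Type u} {n : ℕ} (p : O.obj n)
    (x : Fin n → X) : Lan.mk p x = Lan.map (fun i => x i.down) (generic O p) := rfl

/-- This lemma and the next two rewrite the operad structure in terms of `Lan.map`, `Lan.pure` and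
`Lan.join`, all of which a monad isomorphism preserves. -/
theorem generic_act {O : WOperad.{u} W} {m n : ℕ} (α : Fin m → Fin n) (hα : W.Mem α)
    (p : O.obj m) :
    generic O (O.act α hα p) = Lan.map (fun i => ULift.up (α i.down)) (generic O p) :=
  Lan.mk_act α hα p _

theorem generic_ido (O : WOperad.{u} W) : generic O O.ido = Lan.pure (ULift.up 0) := by
  unfold generic Lan.pure
  congr 1
  funext i
  rw [Subsingleton.elim i 0]

theorem generic_subst {O : WOperad.{u} W} {n : ℕ} {m : Fin n → ℕ} (q : O.obj n)
    (p : ∀ i, O.obj (m i)) :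
    generic O (O.subst q p) = Lan.join (Lan.map
      (fun j => Lan.map (fun i => ULift.up (finSigmaFinEquiv ⟨j.down, i.down⟩))
        (generic O (p j.down))) (generic O q)) := by
  refine Eq.trans ?_ (Lan.join_mk q p fun j i => ULift.up (finSigmaFinEquiv ⟨j, i⟩)).symm
  unfold generic
  congr 1
  funext k
  obtain ⟨⟨i, a⟩, rfl⟩ := finSigmaFinEquiv.surjective k
  rw [flattenTuple_apply]

end WOperad

/-- Closure properties of a verbal category under which the elements of a `W`-operad can be
recovered from its monad. -/
structure VerbalCategory.Cancellative (W : VerbalCategory) : Prop where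
  of_comp : ∀ {l m n : ℕ} {β : Fin m → Fin n} {α : Fin l → Fin m},
    W.Mem α → W.Mem (β ∘ α) → W.Mem β
  of_comp_comp : ∀ {k l m n : ℕ} {β : Fin m → Fin n} {α : Fin l → Fin m} {γ : Fin k → Fin l},
    W.Mem (β ∘ α) → W.Mem (α ∘ γ) → W.Mem β

/-- In the second condition the middle map is injective by the first composite and surjective by the
second, so it can be cancelled. -/
theorem Fbij_cancellative : Fbij.Cancellative where
  of_comp {_ _ _ β α} (hα : Function.Bijective α) (h : Function.Bijective (β ∘ α)) :=
    (Function.Bijective.of_comp_iff β hα).1 h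
  of_comp_comp {_ _ _ _ β α γ} (h1 : Function.Bijective (β ∘ α))
      (h2 : Function.Bijective (α ∘ γ)) :=
    (Function.Bijective.of_comp_iff β ⟨h1.1.of_comp, h2.2.of_comp⟩).1 h1

theorem Fsurj_cancellative : Fsurj.Cancellative where
  of_comp _ h := Function.Surjective.of_comp h
  of_comp_comp h _ := Function.Surjective.of_comp h

theorem Fall_cancellative : Fall.Cancellative where
  of_comp _ _ := trivial
  of_comp_comp _ _ := trivial

/-! ### Monad isomorphisms come from operad isomorphisms -/

namespace WOperad

variable {W : VerbalCategory}

open Classical in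
/-- The element `x p` for a class `[p, x]` with `x` in `W`, and `none` for the other classes. -/
noncomputable def evalMem (hW : W.Cancellative) (O : WOperad.{u} W) {n : ℕ} :
    O.Lan (ULift.{u} (Fin n)) → Option (O.obj n) :=
  Quot.lift (fun a => if h : W.Mem (ULift.down ∘ a.2.2) then some (O.act _ h a.2.1) else none) (by
    rintro ⟨m, p, x⟩ ⟨k, q, y⟩ ⟨α, hα, h1, h2⟩
    dsimp only at α hα h1 h2 ⊢
    subst h1 h2
    by_cases hy : W.Mem (ULift.down ∘ y)
    · have hyα : W.Mem (ULift.down ∘ (y ∘ α)) := W.comp_mem hy hα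
      rw [dif_pos hy, dif_pos hyα]
      exact congrArg some (O.act_comp (ULift.down ∘ y) α hy hα p)
    -- This is where `of_comp` is needed: a tuple outside `W` must not enter `W` by precomposition
    -- with a morphism of `W`.
    · have hyα : ¬ W.Mem (ULift.down ∘ (y ∘ α)) := fun h => hy (hW.of_comp hα h)
      rw [dif_neg hy, dif_neg hyα])

theorem evalMem_mk (hW : W.Cancellative) {O : WOperad.{u} W} {m n : ℕ} (p : O.obj m)
    (x : Fin m → ULift.{u} (Fin n)) (h : W.Mem (ULift.down ∘ x)) :
    evalMem hW O (Lan.mk p x) = some (O.act _ h p) :=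
  dif_pos h

theorem evalMem_mk_eq_none (hW : W.Cancellative) {O : WOperad.{u} W} {m n : ℕ} (p : O.obj m)
    (x : Fin m → ULift.{u} (Fin n)) (h : ¬ W.Mem (ULift.down ∘ x)) :
    evalMem hW O (Lan.mk p x) = none :=
  dif_neg h

theorem evalMem_generic (hW : W.Cancellative) {O : WOperad.{u} W} {n : ℕ} (p : O.obj n) :
    evalMem hW O (generic O p) = some p :=
  (evalMem_mk hW p _ (W.id_mem n)).trans (congrArg some (O.act_id p))

theorem generic_injective (hW : W.Cancellative) {O : WOperad.{u} W} {n : ℕ} :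
    Function.Injective (generic O (n := n)) := fun p q h =>
  Option.some_injective _ <| by rw [← evalMem_generic hW p, h, evalMem_generic]

theorem mem_of_mk_eq_generic (hW : W.Cancellative) {O : WOperad.{u} W} {m n : ℕ} {p : O.obj m}
    {x : Fin m → ULift.{u} (Fin n)} {q : O.obj n} (h : Lan.mk p x = generic O q) :
    W.Mem (ULift.down ∘ x) := by
  by_contra hx
  have h1 := evalMem_mk_eq_none hW p x hx
  rw [h, evalMem_generic] at h1
  exact Option.some_ne_none _ h1

/-- Apply `e`, its inverse and `e` again, each time to the generic class of the operation just
found, and call the tuples `x`, `y`, `z`. Both round trips return generic classes, so `x ∘ y` and `y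
∘ z` lie in `W`; hence so does `x`, and it can be absorbed into the action. -/
theorem exists_generic_eq (hW : W.Cancellative) {O P : WOperad.{u} W}
    (e : O.toMonad ≅ P.toMonad) {n : ℕ} (p : O.obj n) :
    ∃ q : P.obj n, generic P q = isoApp e _ (generic O p) := by
  obtain ⟨m, q, x, hq⟩ : ∃ (m : ℕ) (q : P.obj m) (x : Fin m → ULift.{u} (Fin n)),
      isoApp e _ (generic O p) = Lan.mk q x := by
    induction isoApp e _ (generic O p) using Lan.ind with
    | h q x => exact ⟨_, q, x, rfl⟩
  obtain ⟨k, r, y, hr⟩ : ∃ (k : ℕ) (r : O.obj k) (y : Fin k → ULift.{u} (Fin m)),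
      isoApp e.symm _ (generic P q) = Lan.mk r y := by
    induction isoApp e.symm _ (generic P q) using Lan.ind with
    | h q x => exact ⟨_, q, x, rfl⟩
  obtain ⟨l, s, z, hs⟩ : ∃ (l : ℕ) (s : P.obj l) (z : Fin l → ULift.{u} (Fin k)),
      isoApp e _ (generic O r) = Lan.mk s z := by
    induction isoApp e _ (generic O r) using Lan.ind with
    | h q x => exact ⟨_, q, x, rfl⟩
  have h1 : Lan.mk r ((fun i => x i.down) ∘ y) = generic O p := by
    rw [← isoApp_symm_isoApp e (generic O p), hq, mk_eq_map_generic q x, isoApp_map, hr,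
      Lan.map_mk]
  have h2 : Lan.mk s ((fun i => y i.down) ∘ z) = generic P q := by
    rw [← isoApp_symm_isoApp e.symm (generic P q), hr, mk_eq_map_generic r y, isoApp_map]
    exact congrArg (Lan.map _) hs.symm
  have hx : W.Mem (ULift.down ∘ x) :=
    hW.of_comp_comp (β := ULift.down ∘ x) (α := ULift.down ∘ y) (γ := ULift.down ∘ z)
      (mem_of_mk_eq_generic hW h1) (mem_of_mk_eq_generic hW h2)
  exact ⟨P.act _ hx q, hq ▸ Lan.mk_act _ hx q _⟩

/-- The map on `n`-ary elements determined by a monad isomorphism. -/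
noncomputable def transfer (hW : W.Cancellative) {O P : WOperad.{u} W}
    (e : O.toMonad ≅ P.toMonad) {n : ℕ} (p : O.obj n) : P.obj n :=
  (exists_generic_eq hW e p).choose

theorem generic_transfer (hW : W.Cancellative) {O P : WOperad.{u} W}
    (e : O.toMonad ≅ P.toMonad) {n : ℕ} (p : O.obj n) :
    generic P (transfer hW e p) = isoApp e _ (generic O p) :=
  (exists_generic_eq hW e p).choose_spec

theorem transfer_symm_transfer (hW : W.Cancellative) {O P : WOperad.{u} W}
    (e : O.toMonad ≅ P.toMonad) {n : ℕ} (p : O.obj n) :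
    transfer hW e.symm (transfer hW e p) = p :=
  generic_injective hW <| by rw [generic_transfer, generic_transfer, isoApp_symm_isoApp]

/-- The morphism of operads determined by a monad isomorphism. -/
noncomputable def transferHom (hW : W.Cancellative) {O P : WOperad.{u} W}
    (e : O.toMonad ≅ P.toMonad) : Hom O P where
  app _ p := transfer hW e p
  naturality α hα p := generic_injective hW <| by
    rw [generic_transfer, generic_act, generic_act, isoApp_map, generic_transfer]
  app_ido := generic_injective hW <| by
    rw [generic_transfer, generic_ido, generic_ido, isoApp_pure]
  app_subst q p := generic_injective hW <| by
    rw [generic_transfer, generic_subst, generic_subst, isoApp_join, isoApp_map, isoApp_map,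
      generic_transfer]
    simp only [generic_transfer, ← isoApp_map]
    -- What remains is functoriality of `Lan.map`, which is definitional on a representative.
    induction isoApp e _ (generic O q) using Lan.ind with
    | h r x => rfl

theorem nonempty_iso_of_toMonad_iso (hW : W.Cancellative) {O P : WOperad.{u} W}
    (e : O.toMonad ≅ P.toMonad) : Nonempty (O ≅ P) :=
  ⟨{ hom := transferHom hW e
     inv := transferHom hW e.symm
     hom_inv_id := Hom.ext <| funext fun _ => funext fun p => transfer_symm_transfer hW e p
     inv_hom_id := Hom.ext <| funext fun _ => funext fun p =>
      transfer_symm_transfer hW e.symm p }⟩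

end WOperad

theorem VerbalCategory.Cancellative.isUniquelyOperadic {W : VerbalCategory}
    (hW : W.Cancellative) {S : Monad (Type u)} (hS : IsOperadic W S) :
    IsUniquelyOperadic W S := by
  obtain ⟨O, ⟨e⟩⟩ := hS
  exact ⟨O, ⟨e⟩, fun P ⟨e'⟩ => WOperad.nonempty_iso_of_toMonad_iso hW (e' ≪≫ e.symm)⟩

theorem exists_not_isUniquelyOperadic {W : VerbalCategory} {O P : WOperad.{u} W}
    (e : Nonempty (O.toMonad ≅ P.toMonad)) (h : IsEmpty (O ≅ P)) :
    ∃ S : Monad (Type u), IsOperadic W S ∧ ¬ IsUniquelyOperadic W S := by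
  refine ⟨P.toMonad, ⟨P, ⟨Iso.refl _⟩⟩, ?_⟩
  rintro ⟨Q, -, hQ⟩
  obtain ⟨i⟩ := hQ O e
  obtain ⟨j⟩ := hQ P ⟨Iso.refl _⟩
  exact h.elim (i ≪≫ j.symm)

/-! ## Operads whose monad is trivial on nonempty sets -/

theorem sum_fin_pos {n : ℕ} {m : Fin n → ℕ} (hn : 0 < n) (hm : ∀ i, 0 < m i) :
    0 < ∑ i, m i :=
  (hm ⟨0, hn⟩).trans_le (Finset.single_le_sum (f := m) (fun _ _ => Nat.zero_le _)
    (Finset.mem_univ _))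

theorem sum_fin_eq_one {n : ℕ} {m : Fin n → ℕ} (hn : n = 1) (hm : ∀ i, m i = 1) :
    ∑ i, m i = 1 := by
  subst hn
  simp [hm]

theorem eq_one_of_sum_fin_eq_one {n : ℕ} {m : Fin n → ℕ} (hn : 0 < n) (hm : ∀ i, 0 < m i)
    (h : ∑ i, m i = 1) : n = 1 ∧ ∀ i, m i = 1 := by
  have h1 : ∑ _i : Fin n, 1 ≤ ∑ i, m i := Finset.sum_le_sum fun i _ => hm i
  refine ⟨by simp at h1; omega, fun i => ?_⟩
  have h2 : m i ≤ ∑ i, m i := Finset.single_le_sum (f := m) (fun _ _ => Nat.zero_le _)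
    (Finset.mem_univ i)
  have := hm i
  omega

theorem pos_of_fin_map {m n : ℕ} (α : Fin m → Fin n) (h : 0 < m) : 0 < n :=
  Fin.pos (α ⟨0, h⟩)

/-- The `W`-operad with one element in every positive arity and none in arity `0`. -/
def positiveOperad (W : VerbalCategory) : WOperad.{u} W where
  obj n := ULift (PLift (0 < n))
  act α _ p := ⟨⟨pos_of_fin_map α p.down.down⟩⟩
  act_id _ := rfl
  act_comp _ _ _ _ _ := rfl
  ido := ⟨⟨one_pos⟩⟩
  subst q p := ⟨⟨sum_fin_pos q.down.down fun i => (p i).down.down⟩⟩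
  subst_act _ _ _ _ _ _ _ _ := rfl
  subst_ido _ := rfl
  subst_idos _ := rfl
  subst_assoc _ _ _ := rfl

/-- The `W`-operad with one non-identity element in every positive arity and the identity, where
substitution yields the identity only if all its arguments are the identity. An element is encoded
by the proposition that it is the identity. -/
def positiveOperadWithId (W : VerbalCategory)
    (hW : ∀ {m n : ℕ} {α : Fin m → Fin n}, W.Mem α → Function.Injective α) : WOperad.{u} W where
  obj n := ULift {P : Prop // 0 < n ∧ (P → n = 1)}
  act {m n} α _ p := ⟨⟨p.down.1 ∧ n = 1, pos_of_fin_map α p.down.2.1, And.right⟩⟩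
  act_id p := ULift.ext _ _ <| Subtype.ext <| propext ⟨And.left, fun h => ⟨h, p.down.2.2 h⟩⟩
  act_comp {l m n} β α hβ hα p := ULift.ext _ _ <| Subtype.ext <| propext <| by
    refine ⟨fun h => ⟨⟨h.1, ?_⟩, h.2⟩, fun h => ⟨h.1.1, h.2⟩⟩
    have h1 := pos_of_fin_map α p.down.2.1
    -- Without injectivity, an identity could be lost in an intermediate arity above 1 while the
    -- direct action to arity 1 keeps it.
    have h2 := Fintype.card_le_of_injective β (hW hβ)
    simp only [Fintype.card_fin] at h2
    have := h.2
    omega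
  ido := ⟨⟨True, one_pos, fun _ => rfl⟩⟩
  subst q p := ⟨⟨q.down.1 ∧ ∀ i, (p i).down.1, sum_fin_pos q.down.2.1 fun i => (p i).down.2.1,
    fun h => sum_fin_eq_one (q.down.2.2 h.1) fun i => (p i).down.2.2 (h.2 i)⟩⟩
  subst_act {n' n} β hβ {m' m} α hα q p := ULift.ext _ _ <| Subtype.ext <| propext <| by
    constructor
    · rintro ⟨⟨h1, h2⟩, h3⟩
      exact ⟨⟨h1, fun i => (h3 (β i)).1⟩, sum_fin_eq_one h2 fun i => (h3 i).2⟩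
    · rintro ⟨⟨h1, h2⟩, h3⟩
      have hn := pos_of_fin_map β q.down.2.1
      -- A sum of positive arities equal to 1 has a single summand, so `β` reaches every index and
      -- no `p i` escapes the hypothesis.
      obtain ⟨h4, h5⟩ := eq_one_of_sum_fin_eq_one hn
        (fun i => pos_of_fin_map (α i) (p i).down.2.1) h3
      refine ⟨⟨h1, h4⟩, fun i => ⟨?_, h5 i⟩⟩
      subst h4
      rw [Subsingleton.elim i (β ⟨0, q.down.2.1⟩)]
      exact h2 _
  subst_ido p := ULift.ext _ _ <| Subtype.ext <| propext
    ⟨fun h => h.1.2 0, fun h => ⟨⟨trivial, fun _ => h⟩, p.down.2.2 h⟩⟩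
  subst_idos p := ULift.ext _ _ <| Subtype.ext <| propext
    ⟨fun h => h.1.1, fun h => ⟨⟨h, fun _ => trivial⟩, p.down.2.2 h⟩⟩
  subst_assoc {n m l} r q p := ULift.ext _ _ <| Subtype.ext <| propext <| by
    constructor
    · rintro ⟨⟨h1, h2⟩, -⟩
      exact ⟨⟨h1, fun j => (h2 j).1⟩, fun k => (h2 _).2 _⟩
    · rintro ⟨⟨h1, h2⟩, h3⟩
      have h4 : ∀ j i, (p j i).down.1 := fun j i =>
        (congrArg (fun y : (j : Fin n) × Fin (m j) => (p y.1 y.2).down.1)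
          (Equiv.symm_apply_apply _ _)).mp (h3 (finSigmaFinEquiv ⟨j, i⟩))
      refine ⟨⟨h1, fun j => ⟨h2 j, h4 j⟩⟩, ?_⟩
      rw [← sum_sum_eq_sum_finSigma]
      exact sum_fin_eq_one (r.down.2.2 h1) fun j =>
        sum_fin_eq_one ((q j).down.2.2 (h2 j)) fun i => (p j i).down.2.2 (h4 j i)

/-! ### Monads with at most one element in each value -/

namespace WOperad

variable {W : VerbalCategory}

/-- Both `[p, x]` and `[q, y]` can be rewritten over the concatenated tuple, by acting along the two
coproduct inclusions; there the operations agree. -/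
theorem Lan.subsingleton {O : WOperad.{u} W}
    (hl : ∀ m n : ℕ, W.Mem (Fin.castAdd n : Fin m → Fin (m + n)))
    (hr : ∀ m n : ℕ, W.Mem (Fin.natAdd m : Fin n → Fin (m + n)))
    (h : ∀ {m n : ℕ} (p : O.obj m) (q : O.obj n), O.act _ (hl m n) p = O.act _ (hr m n) q)
    (X : Type u) : Subsingleton (O.Lan X) := by
  refine ⟨fun s t => ?_⟩
  induction s using Lan.ind with
  | @h m p x =>
    induction t using Lan.ind with
    | @h n q y =>
      have h1 := Lan.mk_act _ (hl m n) p (Fin.append x y)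
      have h2 := Lan.mk_act _ (hr m n) q (Fin.append x y)
      have h3 : Fin.append x y ∘ Fin.castAdd n = x := funext fun i => Fin.append_left x y i
      have h4 : Fin.append x y ∘ Fin.natAdd m = y := funext fun i => Fin.append_right x y i
      rw [h3] at h1
      rw [h4] at h2
      rw [← h1, ← h2, h]

/-- If the monads of two operads without elements of arity `0` have only subsingleton values,
then they are isomorphic. -/
noncomputable def toMonadIsoOfSubsingleton {O P : WOperad.{u} W} (hO : ∀ X, Subsingleton (O.Lan X))
    (hP : ∀ X, Subsingleton (P.Lan X)) (hO' : ∀ {n}, O.obj n → 0 < n)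
    (hP' : ∀ {n}, P.obj n → 0 < n) : O.toMonad ≅ P.toMonad :=
  MonadIso.mk
    (NatIso.ofComponents (fun X =>
      -- Positive arity supplies an element of `X`, so the two monads are empty on the same sets.
      { hom := ↾(Quot.lift (fun a => Lan.pure (a.2.2 ⟨0, hO' a.2.1⟩))
          fun _ _ _ => (hP X).elim _ _ : O.Lan X → P.Lan X)
        inv := ↾(Quot.lift (fun a => Lan.pure (a.2.2 ⟨0, hP' a.2.1⟩))
          fun _ _ _ => (hO X).elim _ _ : P.Lan X → O.Lan X)
        hom_inv_id := by ext t; exact (hO X).elim _ _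
        inv_hom_id := by ext t; exact (hP X).elim _ _ })
      (fun {X Y} f => by ext t; exact (hP Y).elim _ _))
    (fun X => by ext t; exact (hP X).elim _ _)
    (fun X => by ext t; exact (hP X).elim _ _)

end WOperad

/-- The operads already differ in cardinality in arity 1: two elements against one. -/
theorem isEmpty_positiveOperadWithId_iso (W : VerbalCategory)
    (hW : ∀ {m n : ℕ} {α : Fin m → Fin n}, W.Mem α → Function.Injective α) :
    IsEmpty (positiveOperadWithId.{u} W hW ≅ positiveOperad.{u} W) := by
  refine ⟨fun e => ?_⟩
  have h1 : ∀ a : (positiveOperadWithId.{u} W hW).obj 1, e.inv.app 1 (e.hom.app 1 a) = a :=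
    fun a => congrArg
      (fun f : positiveOperadWithId.{u} W hW ⟶ positiveOperadWithId.{u} W hW => f.app 1 a)
      e.hom_inv_id
  let a : (positiveOperadWithId.{u} W hW).obj 1 := ⟨⟨True, one_pos, fun _ => rfl⟩⟩
  let b : (positiveOperadWithId.{u} W hW).obj 1 := ⟨⟨False, one_pos, False.elim⟩⟩
  have h2 : a = b := by
    rw [← h1 a, ← h1 b]
    exact congrArg (e.inv.app 1) (ULift.ext _ _ (Subsingleton.elim _ _))
  have h3 : True = False := congrArg (fun c => c.down.1) h2
  exact h3 ▸ trivial

theorem exists_not_isUniquelyOperadic_of_injective (W : VerbalCategory)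
    (hW : ∀ {m n : ℕ} {α : Fin m → Fin n}, W.Mem α → Function.Injective α)
    (hl : ∀ m n : ℕ, W.Mem (Fin.castAdd n : Fin m → Fin (m + n)))
    (hr : ∀ m n : ℕ, W.Mem (Fin.natAdd m : Fin n → Fin (m + n))) :
    ∃ S : Monad (Type u), IsOperadic W S ∧ ¬ IsUniquelyOperadic W S := by
  refine exists_not_isUniquelyOperadic (O := positiveOperadWithId W hW) (P := positiveOperad W)
    ⟨WOperad.toMonadIsoOfSubsingleton
    (WOperad.Lan.subsingleton hl hr fun {m n} p q => ?_)
    (WOperad.Lan.subsingleton hl hr fun {m n} p q => rfl)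
    (fun p => p.down.2.1) (fun p => p.down.down)⟩ (isEmpty_positiveOperadWithId_iso W hW)
  -- Both actions land in arity `m + n ≥ 2`, where no operation is the identity.
  refine ULift.ext _ _ <| Subtype.ext <| propext ?_
  have h1 := p.down.2.1
  have h2 := q.down.2.1
  constructor
  · rintro ⟨-, h⟩
    omega
  · rintro ⟨-, h⟩
    omega

/-! ## Plain operads given by a monoid and a selected position -/

/-- A choice of an element of each nonempty finite ordinal that is compatible with the chosen
coproducts. -/
structure Selection where
  pos : ∀ {n : ℕ}, 0 < n → Fin n
  pos_sum : ∀ {n : ℕ} {m : Fin n → ℕ} (hn : 0 < n) (hm : ∀ i, 0 < m i)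
    (h : 0 < ∑ i, m i), pos h = finSigmaFinEquiv ⟨pos hn, pos (hm _)⟩

/-- The selection of the least element. -/
def Selection.first : Selection where
  pos h := ⟨0, h⟩
  pos_sum {n m} hn hm h := by
    -- The order on a chosen coproduct is lexicographic, so nothing lies below the pair of least
    -- elements.
    obtain ⟨⟨i, a⟩, hk⟩ := finSigmaFinEquiv.surjective (⟨0, h⟩ : Fin (∑ i, m i))
    by_contra hne
    have h1 : finSigmaFinEquiv (n := m) ⟨⟨0, hn⟩, ⟨0, hm _⟩⟩ ≠ ⟨0, h⟩ := fun h => hne h.symm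
    rcases lt_or_gt_of_ne h1 with h2 | h2
    · exact absurd h2 (Nat.not_lt_zero _)
    · rw [← hk] at h2
      rcases finSigma_lt_cases h2 with h3 | ⟨h3, h4⟩
      · exact absurd h3 (Nat.not_lt_zero _)
      · exact absurd h4 (Nat.not_lt_zero _)

/-- The selection of the greatest element. -/
def Selection.last : Selection where
  pos {n} h := ⟨n - 1, Nat.sub_lt h one_pos⟩
  pos_sum {n m} hn hm h := by
    obtain ⟨⟨i, a⟩, hk⟩ := finSigmaFinEquiv.surjective
      (⟨∑ i, m i - 1, Nat.sub_lt h one_pos⟩ : Fin (∑ i, m i))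
    by_contra hne
    rw [← hk] at hne
    rcases lt_or_gt_of_ne hne with h2 | h2
    · rw [hk, Fin.lt_def] at h2
      dsimp only at h2
      omega
    · rcases finSigma_lt_cases h2 with h3 | ⟨h3, h4⟩
      · have := i.2
        rw [Fin.lt_def] at h3
        dsimp only at h3
        omega
      · dsimp only at h3
        subst h3
        have := a.2
        rw [Fin.lt_def] at h4
        simp only [Fin.val_cast] at h4
        omega

/-- The plain operad whose elements of each positive arity are those of a monoid `M`, with
`subst(q, p) = q * p_s` for the selected position `s`. -/
def selectionOperad (s : Selection) (M : Type u) [Monoid M] : WOperad.{u} Fid where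
  obj n := {_a : M // 0 < n}
  act α _ p := ⟨p.1, pos_of_fin_map α p.2⟩
  act_id _ := rfl
  act_comp _ _ _ _ _ := rfl
  ido := ⟨1, one_pos⟩
  subst q p := ⟨q.1 * (p (s.pos q.2)).1, sum_fin_pos q.2 fun i => (p i).2⟩
  subst_act {n' n} β hβ {m' m} α hα q p := by
    obtain ⟨h, hβ⟩ := hβ
    subst h
    have hb : β = id := funext fun i => Fin.ext (hβ i)
    subst hb
    rfl
  subst_ido p := Subtype.ext (one_mul _)
  subst_idos p := Subtype.ext (mul_one _)
  subst_assoc {n m l} r q p := by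
    refine Subtype.ext ?_
    dsimp only
    -- The selected position of the concatenation is the one selected inside the selected block, so
    -- both sides multiply the same three monoid elements.
    rw [s.pos_sum r.2 (fun i => (q i).2), mul_assoc]
    exact congrArg (fun y : (j : Fin n) × Fin (m j) => r.1 * ((q (s.pos r.2)).1 * (p y.1 y.2).1))
      (Equiv.symm_apply_apply finSigmaFinEquiv ⟨s.pos r.2, s.pos (q _).2⟩).symm

/-! ### Reversal of tuples -/

theorem strictAnti_verbalSubst {n' n : ℕ} {β : Fin n' → Fin n} {m' m : Fin n → ℕ}
    {α : ∀ i, Fin (m' i) → Fin (m i)} (hβ : StrictAnti β)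
    (hα : ∀ i, StrictAnti (α i)) : StrictAnti (verbalSubst β α) := by
  intro k l h
  obtain ⟨⟨i, a⟩, rfl⟩ := finSigmaFinEquiv.surjective k
  obtain ⟨⟨j, b⟩, rfl⟩ := finSigmaFinEquiv.surjective l
  rw [verbalSubst_apply, verbalSubst_apply]
  rcases finSigma_lt_cases h with h1 | ⟨h1, h2⟩
  · exact finSigma_lt_of_fst_lt _ _ (hβ h1)
  · dsimp only at h1
    subst h1
    exact finSigma_lt_of_snd_lt _ _ _ (hα _ h2)

theorem sum_comp_rev {n : ℕ} (m : Fin n → ℕ) : ∑ i, m (Fin.rev i) = ∑ i, m i :=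
  Equiv.sum_comp Fin.revPerm m

/-- Reversing the blocks and each block is strictly antitone; a further reversal makes it strictly
monotone between equal ordinals, hence the identity. -/
theorem verbalSubst_rev {n : ℕ} (m : Fin n → ℕ) :
    verbalSubst (m := m) (Fin.rev (n := n)) (fun i => Fin.rev (n := m i)) =
      Fin.rev ∘ Fin.cast (sum_comp_rev m) := by
  have h := strictAnti_verbalSubst (m := m) (Fin.rev_strictAnti (n := n))
    fun i => Fin.rev_strictAnti (n := m i)
  rw [← Fin.strictMono_eq_cast (sum_comp_rev m) (Fin.rev_strictAnti.comp h)]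
  funext i
  simp

theorem flattenTuple_rev {X : Type*} {n : ℕ} {m : Fin n → ℕ} (x : ∀ j, Fin (m j) → X) :
    flattenTuple (fun j => x (Fin.rev j) ∘ Fin.rev) =
      flattenTuple x ∘ Fin.rev ∘ Fin.cast (sum_comp_rev m) := by
  rw [← verbalSubst_rev]
  funext k
  obtain ⟨⟨i, a⟩, rfl⟩ := finSigmaFinEquiv.surjective k
  rw [Function.comp_apply, verbalSubst_apply, flattenTuple_apply, flattenTuple_apply]
  rfl

/-- The map `[p, x] ↦ [p, x ∘ rev]`. -/
def revLan (s t : Selection) (M : Type u) [Monoid M] (X : Type u) :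
    (selectionOperad s M).Lan X → (selectionOperad t M).Lan X :=
  Quot.lift (fun a => WOperad.Lan.mk (O := selectionOperad t M) a.2.1 (a.2.2 ∘ Fin.rev)) (by
    rintro ⟨m, p, x⟩ ⟨n, q, y⟩ ⟨α, ⟨h, hα⟩, h1, h2⟩
    dsimp only at α h hα h1 h2 ⊢
    subst h
    -- Over `Fid` the generating relation is equality, so reversal is well defined although it is
    -- not a morphism of `Fid`.
    have ha : α = id := funext fun i => Fin.ext (hα i)
    subst ha h1
    rw [show q = p from h2]
    rfl)

theorem revLan_mk (s t : Selection) (M : Type u) [Monoid M] {X : Type u} {n : ℕ}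
    (p : (selectionOperad s M).obj n) (x : Fin n → X) :
    revLan s t M X (WOperad.Lan.mk p x) =
      WOperad.Lan.mk (O := selectionOperad t M) p (x ∘ Fin.rev) := rfl

theorem revLan_revLan (s t : Selection) (M : Type u) [Monoid M] {X : Type u}
    (a : (selectionOperad s M).Lan X) : revLan t s M X (revLan s t M X a) = a := by
  induction a using WOperad.Lan.ind with
  | h p x =>
    rw [revLan_mk]
    refine (revLan_mk t s M p _).trans (congrArg (WOperad.Lan.mk p) ?_)
    funext i
    simp

/-- Reversing a concatenation reverses the list of blocks too, so the block selected by `t`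
afterwards is the one selected by `s` before. -/
theorem revLan_join (s t : Selection)
    (hst : ∀ {n : ℕ} (h : 0 < n), Fin.rev (t.pos h) = s.pos h) (M : Type u) [Monoid M]
    {X : Type u} (a : (selectionOperad s M).Lan ((selectionOperad s M).Lan X)) :
    revLan s t M X (WOperad.Lan.join a) =
      WOperad.Lan.join (revLan s t M _ (WOperad.Lan.map (revLan s t M X) a)) := by
  induction a using WOperad.Lan.ind with
  | @h n q y =>
    obtain ⟨m, p, x, rfl⟩ := WOperad.Lan.exists_rep y
    rw [WOperad.Lan.join_mk, revLan_mk, WOperad.Lan.map_mk, revLan_mk]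
    refine Eq.trans ?_ (WOperad.Lan.join_mk (O := selectionOperad t M) q (fun j => p (Fin.rev j))
      (fun j => x (Fin.rev j) ∘ Fin.rev)).symm
    rw [flattenTuple_rev]
    refine Eq.trans ?_ (WOperad.Lan.mk_act (O := selectionOperad t M)
      (Fin.cast (sum_comp_rev m)) (Fid.cast_mem _) _ (flattenTuple x ∘ Fin.rev))
    congr 1
    refine Subtype.ext ?_
    change q.1 * (p (s.pos q.2)).1 = q.1 * (p (Fin.rev (t.pos q.2))).1
    rw [hst]

/-- The monads of the operads for opposite selections are isomorphic. -/
noncomputable def selectionOperadMonadIso (s t : Selection)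
    (hst : ∀ {n : ℕ} (h : 0 < n), Fin.rev (t.pos h) = s.pos h) (M : Type u) [Monoid M] :
    (selectionOperad s M).toMonad ≅ (selectionOperad t M).toMonad :=
  MonadIso.mk
    (NatIso.ofComponents (fun X =>
      { hom := ↾(revLan s t M X)
        inv := ↾(revLan t s M X)
        hom_inv_id := by ext a; exact revLan_revLan s t M a
        inv_hom_id := by ext a; exact revLan_revLan t s M a })
      (fun {X Y} f => by
        ext a
        induction a using WOperad.Lan.ind with
        | h p x => rfl))
    (fun X => by ext x; rfl)
    (fun X => by ext a; exact revLan_join s t hst M a)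

/-- Substitute `(c, 1)` into the binary operation `1`. With the first position selected the result
is `c`; its image under an isomorphism sees only the last entry and so does not depend on `c`. Hence
every `c` equals 1. -/
theorem isEmpty_selectionOperad_iso (M : Type u) [Monoid M] [Nontrivial M] :
    IsEmpty (selectionOperad .first M ≅ selectionOperad .last M) := by
  refine ⟨fun e => ?_⟩
  have h1 : ∀ {n : ℕ} (a : (selectionOperad .first M).obj n),
      e.inv.app n (e.hom.app n a) = a :=
    fun {n} a => congrArg
      (fun f : selectionOperad .first M ⟶ selectionOperad .first M => f.app n a) e.hom_inv_id
  obtain ⟨a, b, hab⟩ := exists_pair_ne M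
  let q : (selectionOperad .first M).obj 2 := ⟨1, two_pos⟩
  let p (c : M) : ∀ _ : Fin 2, (selectionOperad .first M).obj 1 :=
    fun i => ⟨if i = 0 then c else 1, one_pos⟩
  have h2 : ∀ c, e.hom.app _ ((selectionOperad .first M).subst q (p c)) =
      e.hom.app _ ((selectionOperad .first M).subst q (p 1)) := fun c => by
    rw [e.hom.app_subst, e.hom.app_subst]
    refine Subtype.ext ?_
    change _ * (e.hom.app 1 (p c 1)).1 = _ * (e.hom.app 1 (p 1 1)).1
    simp [p]
  have h3 : ∀ c, (selectionOperad .first M).subst q (p c) =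
      (selectionOperad .first M).subst q (p 1) := fun c => by
    rw [← h1 ((selectionOperad .first M).subst q (p c)), h2, h1]
  have h4 : ∀ c : M, c = 1 := fun c => by
    have h5 : (1 : M) * c = 1 * 1 := congrArg Subtype.val (h3 c)
    simpa using h5
  exact hab ((h4 a).trans (h4 b).symm)

/-- Any nontrivial monoid would serve; here it is the natural numbers under multiplication. -/
theorem exists_not_isUniquelyOperadic_Fid :
    ∃ S : Monad (Type u), IsOperadic Fid S ∧ ¬ IsUniquelyOperadic Fid S :=
  exists_not_isUniquelyOperadic
    ⟨selectionOperadMonadIso .first .last (fun {n} h => Fin.ext <| by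
      simp only [Selection.first, Selection.last, Fin.val_rev]
      omega) (ULift.{u} ℕ)⟩
    (isEmpty_selectionOperad_iso (ULift.{u} ℕ))

theorem mainTheorem7 :
    (∀ W : VerbalCategory, W = Fbij ∨ W = Fsurj ∨ W = Fall →
      ∀ S : Monad (Type u), IsOperadic W S → IsUniquelyOperadic W S) ∧
    (∀ W : VerbalCategory, W = Fid ∨ W = Fminj ∨ W = Finj →
      ∃ S : Monad (Type u), IsOperadic W S ∧ ¬ IsUniquelyOperadic W S) := by
  constructor
  · rintro W (rfl | rfl | rfl) S hS
    · exact Fbij_cancellative.isUniquelyOperadic hS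
    · exact Fsurj_cancellative.isUniquelyOperadic hS
    · exact Fall_cancellative.isUniquelyOperadic hS
  · rintro W (rfl | rfl | rfl)
    · exact exists_not_isUniquelyOperadic_Fid
    · exact exists_not_isUniquelyOperadic_of_injective Fminj And.right
        (fun m n => ⟨(Fin.strictMono_castAdd n).monotone, Fin.castAdd_injective m n⟩)
        (fun m n => ⟨(Fin.strictMono_natAdd m).monotone, Fin.natAdd_injective n m⟩)
    · exact exists_not_isUniquelyOperadic_of_injective Finj id
        (fun m n => Fin.castAdd_injective m n) (fun m n => Fin.natAdd_injective n m)
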